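/- Throughout, $I=[0,1]$ and all maps are continuous. A subset $S$ of a space $X$ \emph{deforms to a point within $X$} if the inclusion $S\hookrightarrow X$ is homotopic to a constant map. A \emph{metric ANR} is a metrizable space which, whenever it is embedded as a closed subspace of a metrizable space, is a retract of some open neighbourhood of its image. The Lusternik--Schnirelmann category $\mathrm{cat}(X)$ is the least $n$ such that $X$ can be covered by $n$ open sets, each of which deforms to a point within $X$. Let $f\colon C\to W$ be a continuous map. Let $C^I$ be the space of paths $\alpha\colon I\to C$ with the compact-open topology, and let $\pi_f\colon C^I\to C\times W$ be given by $\pi_f(\alpha)=(\alpha(0),f(\alpha(1)))$. The complexity $\mathrm{TC}(f)$ is the least $n$ for which there is a filtration $\emptyset=Q_0\subseteq Q_1\subseteq\dots\subseteq Q_n=C\times W$ by closed sets such that $\pi_f$ admits a continuous partial section over $Q_i\setminus Q_{i-1}$ for $i=1,\dots,n$. A \emph{categorical section} of $f$ over $A\subseteq W$ is a continuous map $s\colon A\to C$ with $f(s(w))=w$ for all $w\in A$ such that $s(A)$ deforms to a point within $C$. The number $\mathrm{csec}(f)$ is the least $n$ for which there is a filtration $\emptyset=A_0\subseteq A_1\subseteq\dots\subseteq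 A_n=W$ by closed sets such that $f$ admits a categorical section over $A_i\setminus A_{i-1}$ for $i=1,\dots,n$. Each of these numbers is $\infty$ if no such $n$ exists. \textbf{Theorem.} Let $C$ be a (non-empty) path-connected space, let $W$ be a metric ANR, and let $f\colon C\to W$ be any continuous map. Then $$\mathrm{cat}(W)\le\mathrm{csec}(f)\le\mathrm{TC}(f),$$ and, whenever $\mathrm{csec}(f)+\mathrm{cat}(C)$ is finite, $$\mathrm{TC}(f)<\mathrm{csec}(f)+\mathrm{cat}(C).$$ -/

import Mathlib

open Topology Set
open scoped unitInterval

universe u v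

/-- A metric ANR: a metrizable space `W` which, whenever it is embedded as a closed subspace in a
metrizable space `X`, is a retract of an open neighbourhood of its image. -/
structure IsMetricANR (W : Type u) [TopologicalSpace W] : Prop where
  metrizable : TopologicalSpace.MetrizableSpace W
  exists_retraction : ∀ (X : Type u) [TopologicalSpace X] [TopologicalSpace.MetrizableSpace X]
    (e : W → X), IsClosedEmbedding e →
      ∃ U : Set X, IsOpen U ∧ range e ⊆ U ∧
        ∃ r : X → W, ContinuousOn r U ∧ ∀ w, r (e w) = w

/-- The subset `S` can be deformed to a point within `X`: the inclusion `S → X` is homotopic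
to a constant map. -/
def DeformsToPoint {X : Type u} [TopologicalSpace X] (S : Set X) : Prop :=
  ContinuousMap.Nullhomotopic (⟨Subtype.val, continuous_subtype_val⟩ : C(S, X))

/-- There is a filtration `∅ = Q 0 ⊆ Q 1 ⊆ ⋯ ⊆ Q n = X` by closed sets such that all the
successive differences `Q i - Q (i - 1)`, `1 ≤ i ≤ n`, have property `P`. -/
def HasClosedFiltration (X : Type u) [TopologicalSpace X] (P : Set X → Prop) (n : ℕ) : Prop :=
  ∃ Q : Fin (n + 1) → Set X, Q 0 = ∅ ∧ Q (Fin.last n) = univ ∧ Monotone Q ∧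
    (∀ i, IsClosed (Q i)) ∧ ∀ i : Fin n, P (Q i.succ \ Q i.castSucc)

/-- The (unnormalized) Lusternik-Schnirelmann category: the least `n` such that `X` can be covered
by `n` open sets, each of which can be deformed to a point within `X`; it is `⊤` if there
is no such `n`. -/
noncomputable def lsCat (X : Type u) [TopologicalSpace X] : ℕ∞ :=
  ⨅ (n : ℕ) (_ : ∃ U : Fin n → Set X,
    (∀ i, IsOpen (U i) ∧ DeformsToPoint (U i)) ∧ ⋃ i, U i = univ), (n : ℕ∞)

section MapInvariants

variable {C : Type u} {W : Type v} [TopologicalSpace C] [TopologicalSpace W]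

/-- The projection `π_f(α) = (α(0), f(α(1)))` from the space of paths in `C` (with the compact-open
topology) to `C × W`. -/
def pathProj (f : C(C, W)) (α : C(I, C)) : C × W :=
  (α 0, f (α 1))

/-- The map `π_f` has a continuous partial section over `Q`. -/
def HasPartialSection (f : C(C, W)) (Q : Set (C × W)) : Prop :=
  ∃ s : C(Q, C(I, C)), ∀ q : Q, pathProj f (s q) = q

/-- The map `f` has a categorical section over `A`: a continuous partial section `s` over `A`
whose image can be deformed to a point within `C`. -/
def HasCategoricalSection (f : C(C, W)) (A : Set W) : Prop :=
  ∃ s : C(A, C), (∀ w : A, f (s w) = w) ∧ DeformsToPoint (range s)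

/-- The topological complexity of the map `f`. -/
noncomputable def mapTC (f : C(C, W)) : ℕ∞ :=
  ⨅ (n : ℕ) (_ : HasClosedFiltration (C × W) (HasPartialSection f) n), (n : ℕ∞)

/-- The minimal length of a closed filtration of `W` with categorical sections of `f` over the
successive differences. -/
noncomputable def csec (f : C(C, W)) : ℕ∞ :=
  ⨅ (n : ℕ) (_ : HasClosedFiltration W (HasCategoricalSection f) n), (n : ℕ∞)

end MapInvariants

/-!
A categorical section deforms its domain to a point of `W`, because `f` carries a contraction of
the image of the section to `W`. A metric ANR is an absolute neighbourhood extensor (Dugundji), so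
null-homotopies on locally closed sets spread to open neighbourhoods, and the strata of a closed
filtration can be replaced by open sets.

A partial section of `π_f` over `Q` is a homotopy on `Q` from the first projection to a map `v`
with `f ∘ v` the second projection. Freezing the first coordinate at `c₀` makes `v` a categorical
section. Conversely, over `S ×ˢ A` with `S` contractible in `C` and a categorical section over `A`,
the two contractions can be joined by a path in `C`.

A closed filtration of length `n` is the same as a lower semicontinuous rank function with values
in `Fin n`. Adding the ranks on `C` and on `W` gives a filtration of `C × W` of length one less than
the sum of the lengths: on a stratum of the sum, each of the two lower semicontinuous ranks is the
difference of a constant and the other one, hence locally constant, so that the stratum is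
topologically a disjoint union of products of strata.
-/

section Dugundji

variable {X E : Type*} [AddCommGroup E] [Module ℝ E] [TopologicalSpace E] [ContinuousAdd E]
  [ContinuousSMul ℝ E]

theorem exists_continuousMap_compl_mem_convexHull [PseudoMetricSpace X] {A : Set X}
    (hA : IsClosed A) (hne : A.Nonempty) (f : X → E) :
    ∃ g : C(↥Aᶜ, E), ∀ x : ↥Aᶜ,
      g x ∈ convexHull ℝ (f '' (A ∩ Metric.ball (x : X) (2 * Metric.infDist (x : X) A))) := by
  refine exists_continuous_forall_mem_convex_of_local_const
    (t := fun x : ↥Aᶜ =>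
      convexHull ℝ (f '' (A ∩ Metric.ball (x : X) (2 * Metric.infDist (x : X) A))))
    (fun x => convex_convexHull ℝ _) ?_
  rintro ⟨x, hx⟩
  have hpos : 0 < Metric.infDist x A := (hA.notMem_iff_infDist_pos hne).1 hx
  obtain ⟨a, haA, ha⟩ : ∃ a ∈ A, dist x a < 2 * Metric.infDist x A :=
    (Metric.infDist_lt_iff hne).1 (by linarith)
  have hopen : IsOpen {y : ↥Aᶜ | dist (y : X) a < 2 * Metric.infDist (y : X) A} :=
    isOpen_lt (by fun_prop)
      (continuous_const.mul ((Metric.continuous_infDist_pt A).comp continuous_subtype_val))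
  refine ⟨f a, ?_⟩
  filter_upwards [hopen.mem_nhds ha] with y hy
  exact subset_convexHull ℝ _ (mem_image_of_mem f ⟨haA, Metric.mem_ball'.2 hy⟩)

/-- **Dugundji extension theorem**. -/
theorem exists_continuous_eqOn_of_isClosed [LocallyConvexSpace ℝ E] [TopologicalSpace X]
    [TopologicalSpace.PseudoMetrizableSpace X] {A : Set X} (hA : IsClosed A) {f : X → E}
    (hf : ContinuousOn f A) : ∃ F : X → E, Continuous F ∧ EqOn F f A := by
  classical
  let := TopologicalSpace.pseudoMetrizableSpacePseudoMetric X
  rcases A.eq_empty_or_nonempty with rfl | hne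
  · exact ⟨0, continuous_const, eqOn_empty _ _⟩
  obtain ⟨g, hg⟩ := exists_continuousMap_compl_mem_convexHull hA hne f
  let F : X → E := fun x => if hx : x ∈ A then f x else g ⟨x, hx⟩
  have hFA : EqOn F f A := fun x hx => dif_pos hx
  have hFcompl : ContinuousOn F Aᶜ := by
    rw [continuousOn_iff_continuous_domRestrict]
    have hF (y : ↥Aᶜ) : F y = g y := dif_neg y.2
    exact g.continuous.congr fun y => (hF y).symm
  refine ⟨F, continuous_iff_continuousAt.2 fun x => ?_, hFA⟩
  by_cases hx : x ∈ A
  swap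
  · exact hFcompl.continuousAt (hA.isOpen_compl.mem_nhds hx)
  rw [ContinuousAt, hFA hx, (LocallyConvexSpace.convex_basis (𝕜 := ℝ) (f x)).tendsto_right_iff]
  rintro V ⟨hV, hVconvex⟩
  obtain ⟨δ, hδ, hδV⟩ := Metric.mem_nhdsWithin_iff.1 (hf x hx hV)
  filter_upwards [Metric.ball_mem_nhds x (show 0 < δ / 3 by positivity)] with y hy
  rw [Metric.mem_ball] at hy
  by_cases hyA : y ∈ A
  · rw [id, hFA hyA]
    exact hδV ⟨Metric.mem_ball.2 (by linarith), hyA⟩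
  · have hFy : F y = g ⟨y, hyA⟩ := dif_neg hyA
    rw [id, hFy]
    refine convexHull_min ?_ hVconvex (hg ⟨y, hyA⟩)
    rintro _ ⟨a, ⟨haA, hay : dist a y < 2 * Metric.infDist y A⟩, rfl⟩
    have hyx : Metric.infDist y A ≤ dist y x := Metric.infDist_le_dist_of_mem hx
    have hax : dist a x < δ := by linarith [dist_triangle a y x]
    exact hδV ⟨hax, haA⟩

end Dugundji

section AbsoluteNeighbourhoodExtensor

theorem exists_isometry_boundedContinuousFunction (X : Type*) [PseudoMetricSpace X] :
    ∃ k : X → BoundedContinuousFunction X ℝ, Isometry k := by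
  rcases isEmpty_or_nonempty X with _ | ⟨⟨x₀⟩⟩
  · exact ⟨isEmptyElim, fun x => isEmptyElim x⟩
  have hbound (x y : X) : ‖dist x y - dist x₀ y‖ ≤ dist x x₀ := abs_dist_sub_le x x₀ y
  refine ⟨fun x => .ofNormedAddCommGroup (fun y => dist x y - dist x₀ y) (by fun_prop)
    (dist x x₀) (hbound x), Isometry.of_dist_eq fun x y => le_antisymm ?_ ?_⟩
  · refine (BoundedContinuousFunction.dist_le dist_nonneg).2 fun z => ?_
    simpa [Real.dist_eq] using abs_dist_sub_le x y z
  · refine le_trans ?_ (BoundedContinuousFunction.dist_coe_le_dist y)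
    simp

/-- The space `E × [0, ∞]` with the points of `Sᶜ × {0}` removed. It makes any subspace `S` of `E`
closed, as `S × {0}`, while `x ↦ (F x, infEDist x A)` maps into it as soon as `F` maps the closed
set `A` into `S`. -/
def closedThickening {E : Type*} (S : Set E) : Set (E × ENNReal) :=
  {p | p.2 = 0 → p.1 ∈ S}

theorem isClosedEmbedding_closedThickening {W E : Type*} [TopologicalSpace W] [TopologicalSpace E]
    {k : W → E} (hk : IsEmbedding k) :
    IsClosedEmbedding
      (fun w => ⟨(k w, 0), fun _ => mem_range_self w⟩ : W → closedThickening (range k)) := by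
  have := hk.continuous
  refine ⟨.of_comp (by fun_prop) (continuous_fst.comp continuous_subtype_val) hk, ?_⟩
  convert isClosed_eq (f := fun z : closedThickening (range k) => z.1.2) (by fun_prop)
    (continuous_const (y := 0)) using 1
  ext z
  constructor
  · rintro ⟨w, rfl⟩
    rfl
  · intro hz
    obtain ⟨w, hw⟩ := z.2 hz
    exact ⟨w, Subtype.ext (Prod.ext hw (Eq.symm hz))⟩

theorem IsMetricANR.exists_extension {W : Type u} [TopologicalSpace W] (hW : IsMetricANR W)
    {X : Type*} [TopologicalSpace X] [TopologicalSpace.PseudoMetrizableSpace X]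
    {A : Set X} (hA : IsClosed A) {f : X → W} (hf : ContinuousOn f A) :
    ∃ U : Set X, IsOpen U ∧ A ⊆ U ∧ ∃ g : X → W, ContinuousOn g U ∧ EqOn g f A := by
  have := hW.metrizable
  let := TopologicalSpace.metrizableSpaceMetric W
  let := TopologicalSpace.pseudoMetrizableSpacePseudoMetric X
  obtain ⟨k, hk⟩ := exists_isometry_boundedContinuousFunction W
  obtain ⟨V, hV, hWV, r, hr, hrk⟩ := hW.exists_retraction _ _
    (isClosedEmbedding_closedThickening hk.isEmbedding)
  obtain ⟨F, hF, hFA⟩ := exists_continuous_eqOn_of_isClosed hA (hk.continuous.comp_continuousOn hf)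
  let j : X → closedThickening (range k) := fun x => ⟨(F x, Metric.infEDist x A), fun hx =>
    ⟨f x, (hFA ((Metric.mem_iff_infEDist_zero_of_closed hA).2 hx)).symm⟩⟩
  have hj : Continuous j := (hF.prodMk Metric.continuous_infEDist).subtype_mk _
  have hjA {x : X} (hx : x ∈ A) : j x = ⟨(k (f x), 0), fun _ => mem_range_self _⟩ :=
    Subtype.ext (Prod.ext (hFA hx) (Metric.infEDist_zero_of_mem hx))
  refine ⟨j ⁻¹' V, hV.preimage hj, fun x hx => ?_, r ∘ j,
    hr.comp hj.continuousOn (mapsTo_preimage _ _), fun x hx => ?_⟩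
  · rw [mem_preimage, hjA hx]
    exact hWV (mem_range_self _)
  · rw [Function.comp_apply, hjA hx, hrk]

theorem exists_continuousOn_of_homotopic_restrict {X Y : Type*} [TopologicalSpace X]
    [TopologicalSpace Y] {f g : C(X, Y)} {S : Set X} (hS : IsClosed S)
    (h : (f.restrict S).Homotopic (g.restrict S)) :
    ∃ φ : X × I → Y, ContinuousOn φ (univ ×ˢ {0} ∪ univ ×ˢ {1} ∪ S ×ˢ univ) ∧
      (∀ x, φ (x, 0) = f x) ∧ ∀ x, φ (x, 1) = g x := by
  classical
  obtain ⟨H⟩ := h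
  let φ : X × I → Y := fun p =>
    if hp : p.1 ∈ S then H (p.2, ⟨p.1, hp⟩) else if p.2 = 0 then f p.1 else g p.1
  have hφ₀ (x : X) : φ (x, 0) = f x := by
    by_cases hx : x ∈ S <;> simp [φ, hx]
  have hφ₁ (x : X) : φ (x, 1) = g x := by
    by_cases hx : x ∈ S <;> simp [φ, hx]
  have hcont₀ : ContinuousOn φ (univ ×ˢ {0}) := by
    refine ContinuousOn.congr (f := fun p => f p.1) (by fun_prop) ?_
    rintro ⟨x, _⟩ ⟨-, rfl⟩
    exact hφ₀ x
  have hcont₁ : ContinuousOn φ (univ ×ˢ {1}) := by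
    refine ContinuousOn.congr (f := fun p => g p.1) (by fun_prop) ?_
    rintro ⟨x, _⟩ ⟨-, rfl⟩
    exact hφ₁ x
  have hcontS : ContinuousOn φ (S ×ˢ univ) := by
    rw [continuousOn_iff_continuous_domRestrict]
    have hH : Continuous fun p : ↥(S ×ˢ (univ : Set I)) => H (p.1.2, ⟨p.1.1, p.2.1⟩) := by fun_prop
    have hφH (p : ↥(S ×ˢ (univ : Set I))) : φ p = H (p.1.2, ⟨p.1.1, p.2.1⟩) := dif_pos p.2.1
    exact hH.congr fun p => (hφH p).symm
  have hcl (t : I) : IsClosed ((univ : Set X) ×ˢ {t}) := isClosed_univ.prod isClosed_singleton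
  exact ⟨φ, (hcont₀.union_of_isClosed hcont₁ (hcl 0) (hcl 1)).union_of_isClosed hcontS
    ((hcl 0).union (hcl 1)) (hS.prod isClosed_univ), hφ₀, hφ₁⟩

theorem IsMetricANR.exists_isOpen_homotopic_restrict {W : Type u} [TopologicalSpace W]
    (hW : IsMetricANR W) {X : Type*} [TopologicalSpace X]
    [TopologicalSpace.PseudoMetrizableSpace X] {f g : C(X, W)} {S : Set X} (hS : IsClosed S)
    (h : (f.restrict S).Homotopic (g.restrict S)) :
    ∃ U : Set X, IsOpen U ∧ S ⊆ U ∧ (f.restrict U).Homotopic (g.restrict U) := by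
  obtain ⟨φ, hφ, hφ₀, hφ₁⟩ := exists_continuousOn_of_homotopic_restrict hS h
  have hcl (t : I) : IsClosed ((univ : Set X) ×ˢ {t}) := isClosed_univ.prod isClosed_singleton
  obtain ⟨N, hN, hsub, G, hG, hGφ⟩ :=
    hW.exists_extension (((hcl 0).union (hcl 1)).union (hS.prod isClosed_univ)) hφ
  let U : Set X := {x | ∀ t : I, (x, t) ∈ N}
  have hU : IsOpen U := by
    refine isOpen_iff_mem_nhds.2 fun x hx => ?_
    have hx' : ∀ᶠ y in 𝓝 x, ∀ t ∈ (univ : Set I), (y, t) ∈ N :=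
      isCompact_univ.eventually_forall_of_forall_eventually fun t _ => hN.mem_nhds (hx t)
    exact hx'.mono fun y hy t => hy t (mem_univ t)
  refine ⟨U, hU, fun x hx t => hsub (Or.inr ⟨hx, mem_univ t⟩),
    ⟨⟨⟨fun p => G (p.2, p.1), ?_⟩, ?_, ?_⟩⟩⟩
  · exact hG.comp_continuous (by fun_prop) fun p => p.2.2 p.1
  · exact fun x => (hGφ (Or.inl (Or.inl ⟨mem_univ _, mem_singleton _⟩))).trans (hφ₀ x)
  · exact fun x => (hGφ (Or.inl (Or.inr ⟨mem_univ _, mem_singleton _⟩))).trans (hφ₁ x)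

end AbsoluteNeighbourhoodExtensor

section Deformation

theorem antitone_deformsToPoint {X : Type u} [TopologicalSpace X] :
    Antitone (DeformsToPoint : Set X → Prop) :=
  fun _ _ hST hT => ContinuousMap.Nullhomotopic.comp_left hT (ContinuousMap.inclusion hST)

theorem deformsToPoint_image_iff {X : Type*} {Y : Type u} [TopologicalSpace X] [TopologicalSpace Y]
    {i : C(X, Y)} (hi : IsEmbedding i) {S : Set X} :
    DeformsToPoint (i '' S) ↔ (i.restrict S).Nullhomotopic := by
  let e : S ≃ₜ i '' S := hi.homeomorphImage S
  refine ⟨fun h => h.comp_left (e : C(S, i '' S)), fun h => ?_⟩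
  unfold DeformsToPoint
  convert h.comp_left (e.symm : C(i '' S, S)) using 1
  ext y
  exact congrArg Subtype.val (e.apply_symm_apply y).symm

theorem DeformsToPoint.exists_isOpen_superset {W : Type u} [TopologicalSpace W]
    (hW : IsMetricANR W) {S : Set W} (hS : IsLocallyClosed S) (h : DeformsToPoint S) :
    ∃ U : Set W, IsOpen U ∧ S ⊆ U ∧ DeformsToPoint U := by
  have := hW.metrizable
  obtain ⟨V, K, hV, hK, rfl⟩ := hS
  let i : C(V, W) := ⟨Subtype.val, continuous_subtype_val⟩
  have hi : IsOpenEmbedding i := hV.isOpenEmbedding_subtypeVal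
  have hVK : V ∩ K = i '' (i ⁻¹' K) := (Subtype.image_preimage_coe V K).symm
  rw [hVK] at h ⊢
  obtain ⟨y, hy⟩ := (deformsToPoint_image_iff hi.isEmbedding).1 h
  obtain ⟨U, hU, hKU, hyU⟩ := hW.exists_isOpen_homotopic_restrict (g := .const V y)
    (hK.preimage i.continuous) hy
  exact ⟨i '' U, hi.isOpenMap U hU, image_mono hKU,
    (deformsToPoint_image_iff hi.isEmbedding).2 ⟨y, hyU⟩⟩

end Deformation

section ClosedFiltration

theorem lowerSemicontinuous_iff_eventually_le {X α : Type*} [TopologicalSpace X] [LinearOrder α]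
    [PredOrder α] {r : X → α} :
    LowerSemicontinuous r ↔ ∀ x, ∀ᶠ y in 𝓝 x, r x ≤ r y := by
  refine ⟨fun h x => ?_, fun h x a ha => (h x).mono fun y hy => ha.trans_le hy⟩
  by_cases hmin : IsMin (r x)
  · exact .of_forall fun y => hmin.isBot (r y)
  · exact (h x _ (Order.pred_lt_of_not_isMin hmin)).mono fun y => Order.le_of_pred_lt

theorem isLocallyClosed_preimage_singleton_of_lowerSemicontinuous {X α : Type*}
    [TopologicalSpace X] [LinearOrder α] [PredOrder α] {r : X → α} (hr : LowerSemicontinuous r)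
    (a : α) : IsLocallyClosed (r ⁻¹' {a}) := by
  refine ⟨r ⁻¹' Ici a, r ⁻¹' Iic a, isOpen_iff_mem_nhds.2 fun x hx => ?_,
    hr.isClosed_preimage a, ?_⟩
  · exact (lowerSemicontinuous_iff_eventually_le.1 hr x).mono fun y => le_trans hx
  · rw [← preimage_inter, Ici_inter_Iic, Icc_self]

theorem exists_forall_mem_iff_castSucc_lt {X : Type*} {n : ℕ} {Q : Fin (n + 1) → Set X}
    (h₀ : Q 0 = ∅) (hlast : Q (Fin.last n) = univ) (hQ : Monotone Q) (x : X) :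
    ∃ i : Fin n, ∀ k, x ∈ Q k ↔ i.castSucc < k := by
  obtain ⟨k₀, hk₀, hmin⟩ := wellFounded_lt.has_min {k | x ∈ Q k} ⟨Fin.last n, by simp [hlast]⟩
  have hne : k₀ ≠ 0 := by
    rintro rfl
    simp [h₀] at hk₀
  obtain ⟨i, rfl⟩ := Fin.exists_succ_eq.2 hne
  refine ⟨i, fun k => ?_⟩
  rw [Fin.castSucc_lt_iff_succ_le]
  exact ⟨fun hk => not_lt.1 (hmin k hk), fun hk => hQ hk hk₀⟩

variable {X : Type u} [TopologicalSpace X] {P : Set X → Prop} {n : ℕ}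

theorem hasClosedFiltration_iff_exists_lowerSemicontinuous :
    HasClosedFiltration X P n ↔
      ∃ r : X → Fin n, LowerSemicontinuous r ∧ ∀ i, P (r ⁻¹' {i}) := by
  constructor
  · rintro ⟨Q, h₀, hlast, hmono, hclosed, hP⟩
    choose r hr using exists_forall_mem_iff_castSucc_lt h₀ hlast hmono
    have hIic (i : Fin n) : r ⁻¹' Iic i = Q i.succ := by
      ext x
      rw [hr, Fin.castSucc_lt_succ_iff, mem_preimage, mem_Iic]
    refine ⟨r, lowerSemicontinuous_iff_isClosed_preimage.2 fun i => hIic i ▸ hclosed _,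
      fun i => ?_⟩
    convert hP i using 1
    ext x
    rw [mem_sdiff, hr, hr, Fin.castSucc_lt_succ_iff, Fin.castSucc_lt_castSucc_iff, not_lt,
      mem_preimage, mem_singleton_iff, le_antisymm_iff]
  · rintro ⟨r, hr, hP⟩
    refine ⟨fun k => {x | (r x).castSucc < k}, by simp, by simp [Fin.castSucc_lt_last],
      fun k l hkl x hx => lt_of_lt_of_le hx hkl, fun k => ?_, fun i => ?_⟩
    · cases k using Fin.cases with
      | zero => simp
      | succ i =>
        convert hr.isClosed_preimage i using 1
        ext x
        exact Fin.castSucc_lt_succ_iff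
    · convert hP i using 1
      ext x
      rw [mem_sdiff, mem_ofPred_eq, mem_ofPred_eq, Fin.castSucc_lt_succ_iff,
        Fin.castSucc_lt_castSucc_iff, not_lt, mem_preimage, mem_singleton_iff, le_antisymm_iff]

theorem HasClosedFiltration.pos [Nonempty X] (h : HasClosedFiltration X P n) : 0 < n := by
  obtain ⟨r, -⟩ := hasClosedFiltration_iff_exists_lowerSemicontinuous.1 h
  exact Fin.pos (r (Classical.arbitrary X))

theorem HasClosedFiltration.preimage {Y : Type v} [TopologicalSpace Y] {P' : Set Y → Prop}
    {g : Y → X} (hg : Continuous g) (hP : ∀ S, P S → P' (g ⁻¹' S))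
    (h : HasClosedFiltration X P n) : HasClosedFiltration Y P' n := by
  obtain ⟨Q, h₀, hlast, hmono, hclosed, hQ⟩ := h
  exact ⟨fun k => g ⁻¹' Q k, by simp [h₀], by simp [hlast],
    fun k l hkl => preimage_mono (hmono hkl), fun k => (hclosed k).preimage hg,
    fun i => hP _ (hQ i)⟩

theorem HasClosedFiltration.exists_openCover {P' : Set X → Prop}
    (hP : ∀ S, IsLocallyClosed S → P S → ∃ U, IsOpen U ∧ S ⊆ U ∧ P' U)
    (h : HasClosedFiltration X P n) :
    ∃ U : Fin n → Set X, (∀ i, IsOpen (U i) ∧ P' (U i)) ∧ ⋃ i, U i = univ := by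
  obtain ⟨r, hr, hPr⟩ := hasClosedFiltration_iff_exists_lowerSemicontinuous.1 h
  choose U hUopen hrU hPU using fun i =>
    hP _ (isLocallyClosed_preimage_singleton_of_lowerSemicontinuous hr i) (hPr i)
  exact ⟨U, fun i => ⟨hUopen i, hPU i⟩, iUnion_eq_univ_iff.2 fun x => ⟨r x, hrU (r x) rfl⟩⟩

theorem hasClosedFiltration_of_openCover (hP : Antitone P) {U : Fin n → Set X}
    (hU : ∀ i, IsOpen (U i) ∧ P (U i)) (hcover : ⋃ i, U i = univ) : HasClosedFiltration X P n := by
  refine ⟨fun k => ⋂ (i : Fin n) (_ : k ≤ i.castSucc), (U i)ᶜ, ?_, ?_, fun k l hkl => ?_,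
    fun k => isClosed_biInter fun i _ => (hU i).1.isClosed_compl, fun i => hP ?_ (hU i).2⟩
  · simp [← compl_iUnion, hcover]
  · simp [(Fin.castSucc_lt_last _).not_ge]
  · exact biInter_mono (fun i hi => hkl.trans hi) fun _ _ => Subset.rfl
  · rintro x ⟨hx, hx'⟩
    simp only [mem_iInter, mem_compl_iff, not_forall, not_not] at hx hx'
    obtain ⟨j, hij, hxj⟩ := hx'
    obtain rfl : i = j := by
      by_contra hne
      exact hx j (Fin.castSucc_lt_iff_succ_le.1
        (Fin.castSucc_lt_castSucc_iff.2 (lt_of_le_of_ne hij hne))) hxj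
    exact hxj

theorem HasClosedFiltration.prod {Y : Type v} [TopologicalSpace Y] {P' : Set Y → Prop}
    {R : Set (X × Y) → Prop} {m : ℕ} (hR : ∀ S T, P S → P' T → R (S ×ˢ T))
    (hglue : ∀ (Q : Set (X × Y)) (g : Q → Fin m), IsLocallyConstant g →
      (∀ q, R (Subtype.val '' (g ⁻¹' {g q}))) → R Q)
    (hX : HasClosedFiltration X P m) (hY : HasClosedFiltration Y P' n) :
    HasClosedFiltration (X × Y) R (m + n - 1) := by
  simp only [hasClosedFiltration_iff_exists_lowerSemicontinuous] at hX hY ⊢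
  obtain ⟨a, ha, haP⟩ := hX
  obtain ⟨b, hb, hbP⟩ := hY
  have hle (p : X × Y) : ∀ᶠ q in 𝓝 p, a p.1 ≤ a q.1 ∧ b p.2 ≤ b q.2 :=
    (continuousAt_fst.eventually (lowerSemicontinuous_iff_eventually_le.1 ha p.1)).and
      (continuousAt_snd.eventually (lowerSemicontinuous_iff_eventually_le.1 hb p.2))
  let r : X × Y → Fin (m + n - 1) := fun p => ⟨a p.1 + b p.2, by omega⟩
  have hr {p q : X × Y} : r p = r q ↔ (a p.1 + b p.2 : ℕ) = a q.1 + b q.2 := Fin.ext_iff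
  refine ⟨r, lowerSemicontinuous_iff_eventually_le.2 fun p => ?_, fun k => ?_⟩
  · filter_upwards [hle p] with q hq
    exact Fin.le_def.2 (add_le_add hq.1 hq.2)
  refine hglue _ (fun q => a q.1.1) ((IsLocallyConstant.iff_eventually_eq _).2 fun p => ?_)
    fun q => ?_
  · filter_upwards [continuous_subtype_val.continuousAt.eventually (hle p)] with q hq
    have hsum := hr.1 (p.2.trans q.2.symm)
    omega
  · convert hR _ _ (haP (a q.1.1)) (hbP (b q.1.2)) using 1
    ext p
    have hpq : p ∈ r ⁻¹' {k} ↔ (a p.1 + b p.2 : ℕ) = a q.1.1 + b q.1.2 := by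
      rw [← hr, q.2]
      rfl
    simp only [mem_image, mem_preimage, mem_singleton_iff, Subtype.exists, exists_and_right,
      exists_eq_right, mem_prod] at hpq ⊢
    grind

end ClosedFiltration

theorem exists_eq_natCast_of_iInf_ne_top {p : ℕ → Prop}
    (h : ⨅ (n : ℕ) (_ : p n), (n : ℕ∞) ≠ ⊤) : ∃ n, p n ∧ ⨅ (n : ℕ) (_ : p n), (n : ℕ∞) = n := by
  have hne : {n | p n}.Nonempty := by
    by_contra hempty
    exact h (iInf₂_eq_top.2 fun n hn => (hempty ⟨n, hn⟩).elim)
  obtain ⟨n, hn, hmin⟩ := csInf_mem (hne.image ((↑) : ℕ → ℕ∞))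
  exact ⟨n, hn, by rw [hmin, sInf_image]; rfl⟩

section MapInvariants

variable {C : Type u} {W : Type v} [TopologicalSpace C] [TopologicalSpace W] {f : C(C, W)}

theorem hasPartialSection_iff_exists_homotopic {Q : Set (C × W)} :
    HasPartialSection f Q ↔ ∃ v : C(Q, C),
      ContinuousMap.Homotopic ⟨fun q => q.1.1, by fun_prop⟩ v ∧ ∀ q : Q, f (v q) = q.1.2 := by
  constructor
  · rintro ⟨s, hs⟩
    exact ⟨⟨fun q => s q 1, by fun_prop⟩, ⟨⟨⟨fun p => s p.2 p.1, by fun_prop⟩,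
      fun q => congrArg Prod.fst (hs q), fun q => rfl⟩⟩, fun q => congrArg Prod.snd (hs q)⟩
  · rintro ⟨v, ⟨H⟩, hv⟩
    exact ⟨(H.toContinuousMap.comp .prodSwap).curry, fun q =>
      Prod.ext (H.apply_zero q) ((congrArg f (H.apply_one q)).trans (hv q))⟩

theorem HasPartialSection.of_isLocallyConstant {ι : Type*} {Q : Set (C × W)} {g : Q → ι}
    (hg : IsLocallyConstant g) (h : ∀ q, HasPartialSection f (Subtype.val '' (g ⁻¹' {g q}))) :
    HasPartialSection f Q := by
  have hfiber : ∀ j : range g, HasPartialSection f (Subtype.val '' (g ⁻¹' {j.1})) := by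
    rintro ⟨_, q, rfl⟩
    exact h q
  choose s hs using hfiber
  let S (j : range g) : Set Q := g ⁻¹' {j.1}
  let φ (j : range g) : C(S j, C(I, C)) :=
    (s j).comp ⟨fun q => ⟨q.1.1, mem_image_of_mem _ q.2⟩, by fun_prop⟩
  let F : C(Q, C(I, C)) := ContinuousMap.liftCover S φ
    (fun i j q hi hj => by
      obtain rfl : i = j := Subtype.ext (Eq.trans (Eq.symm hi) hj)
      rfl)
    fun q => ⟨⟨g q, mem_range_self q⟩, (hg.isOpen_fiber _).mem_nhds rfl⟩
  refine ⟨F, fun q => ?_⟩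
  have hFq : F q = φ ⟨g q, mem_range_self q⟩ ⟨q, rfl⟩ :=
    ContinuousMap.liftCover_coe (S := S) (φ := φ) (i := ⟨g q, mem_range_self q⟩) ⟨q, rfl⟩
  rw [hFq]
  exact hs _ _

theorem HasCategoricalSection.deformsToPoint {A : Set W} (h : HasCategoricalSection f A) :
    DeformsToPoint A := by
  obtain ⟨s, hs, hnull⟩ := h
  let s' : C(A, range s) := ⟨rangeFactorization s, by fun_prop⟩
  unfold DeformsToPoint
  convert (hnull.comp_right f).comp_left s' using 1
  ext w
  exact (hs w).symm

theorem HasPartialSection.hasCategoricalSection {Q : Set (C × W)} (h : HasPartialSection f Q)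
    (c₀ : C) : HasCategoricalSection f (Prod.mk c₀ ⁻¹' Q) := by
  obtain ⟨v, hv, hfv⟩ := hasPartialSection_iff_exists_homotopic.1 h
  let s : C(Prod.mk c₀ ⁻¹' Q, C) := ⟨fun w => v ⟨(c₀, w), w.2⟩, by fun_prop⟩
  have hs (w : Prod.mk c₀ ⁻¹' Q) : f (s w) = w := hfv ⟨(c₀, w), w.2⟩
  have hmem (c : range s) : (c₀, f c) ∈ Q := by
    obtain ⟨_, w, rfl⟩ := c
    rw [hs w]
    exact w.2
  let g : C(range s, Q) := ⟨fun c => ⟨(c₀, f c), hmem c⟩, by fun_prop⟩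
  have hvg : v.comp g = ⟨Subtype.val, continuous_subtype_val⟩ := by
    ext ⟨_, w, rfl⟩
    exact congrArg v (Subtype.ext (Prod.ext rfl (hs w)))
  exact ⟨s, hs, c₀, hvg ▸ (hv.comp (.refl g)).symm⟩

theorem hasPartialSection_prod [PathConnectedSpace C] {S : Set C} {A : Set W}
    (hS : DeformsToPoint S) (hA : HasCategoricalSection f A) : HasPartialSection f (S ×ˢ A) := by
  obtain ⟨c₁, h₁⟩ := hS
  obtain ⟨s, hs, c₂, h₂⟩ := hA
  let p : C(S ×ˢ A, S) := ⟨fun q => ⟨q.1.1, q.2.1⟩, by fun_prop⟩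
  let p' : C(S ×ˢ A, range s) := ⟨fun q => ⟨s ⟨q.1.2, q.2.2⟩, mem_range_self _⟩, by fun_prop⟩
  have hc : (ContinuousMap.const (S ×ˢ A) c₁).Homotopic (ContinuousMap.const _ c₂) := by
    obtain ⟨γ⟩ := PathConnectedSpace.joined c₁ c₂
    exact ⟨γ.toHomotopyConst⟩
  exact hasPartialSection_iff_exists_homotopic.2 ⟨⟨fun q => s ⟨q.1.2, q.2.2⟩, by fun_prop⟩,
    ((h₁.comp (.refl p)).trans hc).trans (h₂.comp (.refl p')).symm, fun q => hs _⟩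

theorem lsCat_le_csec (hW : IsMetricANR W) (f : C(C, W)) : lsCat W ≤ csec f :=
  biInf_mono fun _ hn => hn.exists_openCover fun _ hS hsec =>
    hsec.deformsToPoint.exists_isOpen_superset hW hS

theorem csec_le_mapTC [Nonempty C] (f : C(C, W)) : csec f ≤ mapTC f := by
  obtain ⟨c₀⟩ := ‹Nonempty C›
  exact biInf_mono fun _ hn => hn.preimage (Continuous.prodMk_right c₀) fun _ hQ =>
    hQ.hasCategoricalSection c₀

theorem mapTC_lt_csec_add_lsCat [PathConnectedSpace C] (h : csec f + lsCat C ≠ ⊤) :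
    mapTC f < csec f + lsCat C := by
  obtain ⟨n, hn, hcsec⟩ := exists_eq_natCast_of_iInf_ne_top (ne_top_of_le_ne_top h le_self_add)
  obtain ⟨m, ⟨U, hU, hcover⟩, hcat⟩ :=
    exists_eq_natCast_of_iInf_ne_top (ne_top_of_le_ne_top h le_add_self)
  have hm : HasClosedFiltration C DeformsToPoint m :=
    hasClosedFiltration_of_openCover antitone_deformsToPoint hU hcover
  have hTC : HasClosedFiltration (C × W) (HasPartialSection f) (m + n - 1) :=
    hm.prod (fun _ _ => hasPartialSection_prod) (fun _ _ => .of_isLocallyConstant) hn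
  have hpos := hm.pos
  calc mapTC f ≤ (m + n - 1 : ℕ) := iInf₂_le _ hTC
    _ < (n + m : ℕ) := by exact_mod_cast (by omega : m + n - 1 < n + m)
    _ = csec f + lsCat C := by rw [csec, lsCat, hcsec, hcat, Nat.cast_add]

end MapInvariants

theorem mainTheorem1 {C : Type u} {W : Type v} [TopologicalSpace C] [TopologicalSpace W]
    [PathConnectedSpace C] (hW : IsMetricANR W) (f : C(C, W)) :
    lsCat W ≤ csec f ∧ csec f ≤ mapTC f ∧
      (csec f + lsCat C ≠ ⊤ → mapTC f < csec f + lsCat C) :=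
  ⟨lsCat_le_csec hW f, csec_le_mapTC f, mapTC_lt_csec_add_lsCat⟩
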